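/- Throughout, $\mathbb C^\times$ is regarded as a trivial module. For a finite group $G$, $\mathrm H^2(G,\mathbb C^\times)$ is the group of 2-cocycles $\alpha:G\times G\to\mathbb C^\times$, $\alpha(x,y)\alpha(xy,z)=\alpha(x,yz)\alpha(y,z)$, modulo the 2-coboundaries $(x,y)\mapsto t(x)t(y)t(xy)^{-1}$, $t:G\to\mathbb C^\times$. For a 2-cocycle $\alpha$, $\mathbb C^\alpha G$ is the twisted group algebra: it has $\mathbb C$-basis $\{\bar g: g\in G\}$ and multiplication $\bar g\,\bar h=\alpha(g,h)\overline{gh}$. Write $G\sim_{\mathbb C}H$ if there is a group isomorphism $\psi:\mathrm H^2(G,\mathbb C^\times)\to\mathrm H^2(H,\mathbb C^\times)$ such that $\mathbb C^\alpha G\cong\mathbb C^\beta H$ as $\mathbb C$-algebras whenever $\psi([\alpha])=[\beta]$. For a central subgroup $Z$ of $G$, the inflation map $\inf:\mathrm H^2(G/Z,\mathbb C^\times)\to\mathrm H^2(G,\mathbb C^\times)$ sends $[\alpha]$ to the class of $(x,y)\mapsto\alpha(xZ,yZ)$, and the transgression map $\mathrm{tra}:\mathrm{Hom}(Z,\mathbb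 C^\times)\to\mathrm H^2(G/Z,\mathbb C^\times)$ sends $\chi$ to the class of $(x,y)\mapsto\chi(\mu(x)\mu(y)\mu(xy)^{-1})$, where $\mu:G/Z\to G$ is any section of the quotient map. **Corollary 1.2.** Let $G_1,G_2$ be finite groups and let $Z_j$ be a central subgroup of $G_j$ such that, for $j=1,2$, the sequence $$1\to\mathrm{Hom}(Z_j,\mathbb C^\times)\xrightarrow{\mathrm{tra}_j}\mathrm H^2(G_j/Z_j,\mathbb C^\times)\xrightarrow{\inf_j}\mathrm H^2(G_j,\mathbb C^\times)\to1$$ is exact, where $\mathrm{tra}_j$ and $\inf_j$ are the transgression and inflation maps of $Z_j\le G_j$. Suppose there are group isomorphisms $i:Z_2\to Z_1$ and $\phi:G_2/Z_2\to G_1/Z_1$ such that the induced isomorphisms $$\bar i:\mathrm{Hom}(Z_1,\mathbb C^\times)\to\mathrm{Hom}(Z_2,\mathbb C^\times),\ \chi\mapsto\chi\circ i,\qquad \bar\phi:\mathrm H^2(G_1/Z_1,\mathbb C^\times)\to\mathrm H^2(G_2/Z_2,\mathbb C^\times),\ [\alpha]\mapsto[\alpha\circ(\phi\times\phi)],$$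 satisfy $\bar\phi\circ\mathrm{tra}_1=\mathrm{tra}_2\circ\bar i$. Then $G_1\sim_{\mathbb C}G_2$. -/

import Mathlib

noncomputable section

namespace TGR

/-! ### The second cohomology group with trivial coefficients -/

section Cohomology

/-- `Z²(G, A)`: the group of 2-cocycles of `G` with values in the trivial `G`-module `A`
(written multiplicatively), under pointwise multiplication. -/
def Z2 (G A : Type*) [Group G] [CommGroup A] : Subgroup (G → G → A) where
  carrier := {α | ∀ x y z : G, α x y * α (x * y) z = α x (y * z) * α y z}
  mul_mem' {α β} hα hβ x y z := by
    simp only [Pi.mul_apply]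
    rw [mul_mul_mul_comm, hα x y z, hβ x y z, mul_mul_mul_comm]
  one_mem' x y z := by simp
  inv_mem' {α} hα x y z := by
    simp only [Pi.inv_apply]
    rw [← mul_inv, ← mul_inv, hα x y z]

/-- The 2-coboundaries `(x, y) ↦ t(x) t(y) t(xy)⁻¹`, as a subgroup of the 2-cocycles. -/
def B2 (G A : Type*) [Group G] [CommGroup A] : Subgroup (Z2 G A) where
  carrier := {α | ∃ t : G → A, ∀ x y : G, (α : G → G → A) x y = t x * t y * (t (x * y))⁻¹}
  mul_mem' {α β} hα hβ := by
    obtain ⟨s, hs⟩ := hα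
    obtain ⟨t, ht⟩ := hβ
    refine ⟨s * t, fun x y => ?_⟩
    simp only [Subgroup.coe_mul, Pi.mul_apply, hs, ht, mul_inv]
    simp only [mul_assoc, mul_left_comm]
  one_mem' := ⟨1, fun x y => by simp⟩
  inv_mem' {α} hα := by
    obtain ⟨t, ht⟩ := hα
    refine ⟨t⁻¹, fun x y => ?_⟩
    simp only [Subgroup.coe_inv, Pi.inv_apply, ht, mul_inv]

/-- The second cohomology group `H²(G, A)` of `G` in the trivial `G`-module `A`. -/
abbrev H2 (G A : Type*) [Group G] [CommGroup A] : Type _ := Z2 G A ⧸ B2 G A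

variable {G H A : Type*} [Group G] [Group H] [CommGroup A]

/-- The cohomology class `[α]` of a 2-cocycle `α`. -/
abbrev cls (α : Z2 G A) : H2 G A := (α : Z2 G A ⧸ B2 G A)

/-- Pullback of 2-cocycles along a group homomorphism `f : H → G`:
`α ↦ ((x, y) ↦ α(f x, f y))`. -/
def cocyclePullback (A : Type*) [CommGroup A] (f : H →* G) : Z2 G A →* Z2 H A where
  toFun α := ⟨fun x y => (α : G → G → A) (f x) (f y), fun x y z => by
    simp only [map_mul]
    exact α.2 (f x) (f y) (f z)⟩
  map_one' := rfl
  map_mul' _ _ := rfl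

/-- The homomorphism `H²(G, A) → H²(H, A)`, `[α] ↦ [α ∘ (f × f)]`, induced by a group
homomorphism `f : H → G`. -/
def pullback (A : Type*) [CommGroup A] (f : H →* G) : H2 G A →* H2 H A :=
  QuotientGroup.map (B2 G A) (B2 H A) (cocyclePullback A f) (by
    rintro α ⟨t, ht⟩
    refine ⟨fun x => t (f x), fun x y => ?_⟩
    simp only [map_mul]
    exact ht (f x) (f y))

@[simp] theorem pullback_cls (f : H →* G) (α : Z2 G A) :
    pullback A f (cls α) = cls (cocyclePullback A f α) := rfl

/-- The inflation homomorphism `inf : H²(G/N, A) → H²(G, A)`, `[α] ↦ [α']` with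
`α'(x, y) = α(xN, yN)`. -/
def inflation (A : Type*) [CommGroup A] (N : Subgroup G) [N.Normal] : H2 (G ⧸ N) A →* H2 G A :=
  pullback A (QuotientGroup.mk' N)

end Cohomology

/-! ### Transgression for the central extension `1 → Z → G → G/Z → 1` -/

section Transgression

variable {G : Type*} [Group G] (Z : Subgroup G) [Z.Normal]

/-- `μ : G/Z → G` is a (set-theoretic) section of the quotient map. -/
def IsSection (μ : G ⧸ Z → G) : Prop := ∀ x : G ⧸ Z, (μ x : G ⧸ Z) = x

/-- The factor set `μ(x) μ(y) μ(xy)⁻¹ ∈ Z` of a section `μ`. -/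
def factorSet {μ : G ⧸ Z → G} (hμ : IsSection Z μ) (x y : G ⧸ Z) : Z :=
  ⟨μ x * μ y * (μ (x * y))⁻¹, by
    rw [← QuotientGroup.eq_one_iff]
    simp only [QuotientGroup.mk_mul, QuotientGroup.mk_inv, hμ x, hμ y, hμ (x * y)]
    exact mul_inv_cancel _⟩

variable {Z}

theorem factorSet_cocycle (hZ : Z ≤ Subgroup.center G) {μ : G ⧸ Z → G} (hμ : IsSection Z μ)
    (x y z : G ⧸ Z) :
    factorSet Z hμ x y * factorSet Z hμ (x * y) z
      = factorSet Z hμ x (y * z) * factorSet Z hμ y z := by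
  have h : ∀ g : G, (factorSet Z hμ y z : G) * g = g * (factorSet Z hμ y z : G) := fun g =>
    (Subgroup.mem_center_iff.1 (hZ (factorSet Z hμ y z).2) g).symm
  apply Subtype.ext
  have e1 : ((factorSet Z hμ x y * factorSet Z hμ (x * y) z : Z) : G)
      = μ x * μ y * μ z * (μ (x * y * z))⁻¹ := by
    simp only [factorSet, Subgroup.coe_mul]
    group
  have e2 : ((factorSet Z hμ x (y * z) * factorSet Z hμ y z : Z) : G)
      = μ x * μ y * μ z * (μ (x * y * z))⁻¹ := by
    have : ((factorSet Z hμ x (y * z) * factorSet Z hμ y z : Z) : G)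
        = μ x * ((factorSet Z hμ y z : G) * (μ (y * z) * (μ (x * (y * z)))⁻¹)) := by
      rw [h]
      simp only [Subgroup.coe_mul]
      simp only [factorSet, mul_assoc]
    rw [this]
    simp only [factorSet, mul_assoc, inv_mul_cancel_left]
  rw [e1, e2]

variable {A : Type*} [CommGroup A]

/-- The 2-cocycle `α_χ(x, y) = χ(μ(x) μ(y) μ(xy)⁻¹)` of `G/Z` attached to a section `μ` and
to `χ ∈ Hom(Z, A)`. -/
def traCocycle (hZ : Z ≤ Subgroup.center G) {μ : G ⧸ Z → G} (hμ : IsSection Z μ) (χ : Z →* A) :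
    Z2 (G ⧸ Z) A :=
  ⟨fun x y => χ (factorSet Z hμ x y), fun x y z => by
    rw [← map_mul, ← map_mul, factorSet_cocycle hZ hμ]⟩

theorem isSection_out (Z : Subgroup G) [Z.Normal] :
    IsSection Z (fun x : G ⧸ Z => Quotient.out x) :=
  fun x => QuotientGroup.out_eq' x

/-- The transgression homomorphism `tra : Hom(Z, A) → H²(G/Z, A)`, `χ ↦ [α_χ]`. -/
def transgression (A : Type*) [CommGroup A] (hZ : Z ≤ Subgroup.center G) :
    (Z →* A) →* H2 (G ⧸ Z) A where
  toFun χ := cls (traCocycle hZ (isSection_out Z) χ)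
  map_one' := rfl
  map_mul' _ _ := rfl

/-- The transgression map may be computed with any section. -/
theorem transgression_eq (hZ : Z ≤ Subgroup.center G) {μ : G ⧸ Z → G} (hμ : IsSection Z μ)
    (χ : Z →* A) : transgression A hZ χ = cls (traCocycle hZ hμ χ) := by
  refine QuotientGroup.eq.2 ?_
  set ν : G ⧸ Z → G := fun x => Quotient.out x
  have hν : IsSection Z ν := isSection_out Z
  have hmem : ∀ x, (μ x) * (ν x)⁻¹ ∈ Z := fun x => by
    rw [← QuotientGroup.eq_one_iff]
    simp only [QuotientGroup.mk_mul, QuotientGroup.mk_inv, hμ x, hν x]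
    exact mul_inv_cancel _
  let c : G ⧸ Z → Z := fun x => ⟨_, hmem x⟩
  refine ⟨fun x => χ (c x), fun x y => ?_⟩
  have hc : ∀ x, μ x = (c x : G) * ν x := fun x => by simp [c]
  have hcomm : ∀ (z : Z) (g : G), g * (z : G) = z * g := fun z g =>
    Subgroup.mem_center_iff.1 (hZ z.2) g
  have key : factorSet Z hμ x y = c x * c y * (c (x * y))⁻¹ * factorSet Z hν x y := by
    apply Subtype.ext
    have h1 : (factorSet Z hμ x y : G)
        = (c x : G) * (ν x * (c y : G)) * ν y * ((ν (x * y))⁻¹ * (((c (x * y))⁻¹ : Z) : G)) := by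
      simp only [factorSet, hc, mul_inv_rev, mul_assoc, Subgroup.coe_inv]
    rw [h1, hcomm, hcomm]
    have h2 : ((c x * c y * (c (x * y))⁻¹ * factorSet Z hν x y : Z) : G)
        = (c x : G) * c y * ((((c (x * y))⁻¹ : Z) : G) * (ν x * ν y * (ν (x * y))⁻¹)) := by
      simp only [factorSet, Subgroup.coe_mul, mul_assoc]
    rw [h2, ← hcomm _ (ν x * ν y * (ν (x * y))⁻¹), ← hcomm _ (ν (x * y))⁻¹]
    simp only [mul_assoc]
  change (χ (factorSet Z hν x y))⁻¹ * χ (factorSet Z hμ x y) = _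
  rw [key]
  simp only [map_mul, map_inv]
  rw [mul_comm, mul_inv_cancel_right]

end Transgression

/-! ### Twisted group rings -/

/-- The twisted group ring `R^α G`: the free `R`-module on symbols `ḡ`, `g ∈ G`, with the
multiplication determined by `ḡ h̄ = α(g, h) \overline{gh}`. -/
def TwistedGroupRing {R G : Type*} [CommRing R] [Group G] (_α : Z2 G Rˣ) : Type _ := G →₀ R

namespace TwistedGroupRing

variable {R G : Type*} [CommRing R] [Group G] (α : Z2 G Rˣ)

instance : AddCommGroup (TwistedGroupRing α) := inferInstanceAs (AddCommGroup (G →₀ R))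
instance : Module R (TwistedGroupRing α) := inferInstanceAs (Module R (G →₀ R))

/-- The `R`-basis `ḡ`, `g ∈ G`, of `R^α G`. -/
def basis : Module.Basis G R (TwistedGroupRing α) :=
  Module.Basis.ofRepr (LinearEquiv.refl R (G →₀ R))

/-- The bilinear multiplication of `R^α G`. -/
def mulHom : TwistedGroupRing α →ₗ[R] TwistedGroupRing α →ₗ[R] TwistedGroupRing α :=
  (basis α).constr R fun g => (basis α).constr R fun h =>
    (((α : G → G → Rˣ) g h : Rˣ) : R) • basis α (g * h)

instance : Mul (TwistedGroupRing α) := ⟨fun x y => mulHom α x y⟩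

/-- The identity element `α(1, 1)⁻¹ \bar 1` (a cocycle need not be normalized). -/
instance : One (TwistedGroupRing α) :=
  ⟨((((α : G → G → Rˣ) 1 1)⁻¹ : Rˣ) : R) • basis α 1⟩

theorem mul_def (x y : TwistedGroupRing α) : x * y = mulHom α x y := rfl

theorem one_def :
    (1 : TwistedGroupRing α) = ((((α : G → G → Rˣ) 1 1)⁻¹ : Rˣ) : R) • basis α 1 := rfl

theorem mulHom_basis (g h : G) : mulHom α (basis α g) (basis α h)
    = (((α : G → G → Rˣ) g h : Rˣ) : R) • basis α (g * h) := by
  simp [mulHom, Module.Basis.constr_basis]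

theorem basis_mul_basis (g h : G) : basis α g * basis α h
    = (((α : G → G → Rˣ) g h : Rˣ) : R) • basis α (g * h) := mulHom_basis α g h

theorem cocycle_one_left (h : G) : (α : G → G → Rˣ) 1 h = (α : G → G → Rˣ) 1 1 := by
  have := α.2 1 1 h
  simp only [mul_one, one_mul] at this
  exact (mul_right_cancel this).symm

theorem cocycle_one_right (g : G) : (α : G → G → Rˣ) g 1 = (α : G → G → Rˣ) 1 1 := by
  have := α.2 g 1 1
  simp only [mul_one] at this
  exact mul_left_cancel this

theorem one_mul_aux (x : TwistedGroupRing α) : mulHom α 1 x = x := by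
  have : mulHom α 1 = LinearMap.id := by
    refine (basis α).ext fun g => ?_
    rw [one_def, map_smul, LinearMap.smul_apply, mulHom_basis, cocycle_one_left α g, smul_smul,
      Units.inv_mul, one_smul, one_mul, LinearMap.id_apply]
  rw [this, LinearMap.id_apply]

theorem mul_one_aux (x : TwistedGroupRing α) : mulHom α x 1 = x := by
  have : (mulHom α).flip 1 = LinearMap.id := by
    refine (basis α).ext fun g => ?_
    rw [LinearMap.flip_apply, one_def, map_smul, mulHom_basis, cocycle_one_right α g, smul_smul,
      Units.inv_mul, one_smul, mul_one, LinearMap.id_apply]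
  rw [← LinearMap.flip_apply, this, LinearMap.id_apply]

theorem mul_assoc_aux (x y z : TwistedGroupRing α) :
    mulHom α (mulHom α x y) z = mulHom α x (mulHom α y z) := by
  have hb : ∀ g h k : G, mulHom α (mulHom α (basis α g) (basis α h)) (basis α k)
      = mulHom α (basis α g) (mulHom α (basis α h) (basis α k)) := fun g h k => by
    simp only [mulHom_basis, map_smul, LinearMap.smul_apply, smul_smul]
    rw [← Units.val_mul, ← Units.val_mul, α.2 g h k, mul_comm ((α : G → G → Rˣ) g (h * k)),
      mul_assoc]
  have h1 : ∀ (g h : G) (z : TwistedGroupRing α),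
      mulHom α (mulHom α (basis α g) (basis α h)) z
        = mulHom α (basis α g) (mulHom α (basis α h) z) := fun g h z =>
    LinearMap.congr_fun (f := mulHom α (mulHom α (basis α g) (basis α h)))
      (g := (mulHom α (basis α g)).comp (mulHom α (basis α h)))
      ((basis α).ext fun k => hb g h k) z
  have h2 : ∀ (g : G) (y z : TwistedGroupRing α),
      mulHom α (mulHom α (basis α g) y) z = mulHom α (basis α g) (mulHom α y z) := fun g y z =>
    LinearMap.congr_fun (f := ((mulHom α).flip z).comp (mulHom α (basis α g)))
      (g := (mulHom α (basis α g)).comp ((mulHom α).flip z))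
      ((basis α).ext fun h => h1 g h z) y
  exact LinearMap.congr_fun (f := ((mulHom α).flip z).comp ((mulHom α).flip y))
      (g := (mulHom α).flip (mulHom α y z))
      ((basis α).ext fun g => h2 g y z) x

instance : Ring (TwistedGroupRing α) :=
  { (inferInstance : AddCommGroup (TwistedGroupRing α)) with
    mul := (· * ·)
    one := 1
    left_distrib := fun x y z => by simp only [mul_def, map_add]
    right_distrib := fun x y z => by simp only [mul_def, map_add, LinearMap.add_apply]
    zero_mul := fun x => by simp only [mul_def, map_zero, LinearMap.zero_apply]
    mul_zero := fun x => by simp only [mul_def, map_zero]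
    mul_assoc := mul_assoc_aux α
    one_mul := one_mul_aux α
    mul_one := mul_one_aux α }

instance : Algebra R (TwistedGroupRing α) :=
  Algebra.ofModule
    (fun r x y => by simp only [mul_def, map_smul, LinearMap.smul_apply])
    (fun r x y => by simp only [mul_def, map_smul])

end TwistedGroupRing

/-! ### The relation `G ∼_R H` -/

/-- `G ∼_R H`: there is a group isomorphism `ψ : H²(G, Rˣ) → H²(H, Rˣ)` such that
`R^α G ≅ R^β H` as `R`-algebras whenever `ψ([α]) = [β]`. -/
def TwistedEquiv (R : Type*) [CommRing R] (G H : Type*) [Group G] [Group H] : Prop :=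
  ∃ ψ : H2 G Rˣ ≃* H2 H Rˣ, ∀ (α : Z2 G Rˣ) (β : Z2 H Rˣ), ψ (cls α) = cls β →
    Nonempty (TwistedGroupRing α ≃ₐ[R] TwistedGroupRing β)

end TGR

end

/-! Let `γ` be the inflation to `G` of a cocycle `α` of `G/Z`. In the twisted group algebra of `γ`
the span of `Z` is central and, up to the scalar `α(1,1)`, is the ordinary group algebra of `Z`. It
therefore splits the whole algebra along the characters `χ` of `Z`, and the block at `χ` is the
twisted group algebra of `G/Z` for `α · tra χ`. This is `nonempty_algEquiv_pi`.

Surjectivity of inflation puts every class of `G₁` in this form. Exactness together with the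
commuting square makes the pullback along `φ` carry `ker inf₁ = im tra₁` onto `ker inf₂ = im tra₂`,
so it descends to `ψ` (`exists_mulEquiv_of_map_ker`). The same square matches the block at `χ` with
the block at `χ ∘ i`. Only cohomology classes need to agree, because cohomologous cocycles give
isomorphic algebras (`nonempty_algEquiv_of_cls_eq`). -/

noncomputable section

namespace TGR

/-! ### Homomorphisms out of twisted group rings -/

namespace TwistedGroupRing

variable {R G H : Type*} [CommRing R] [Group G] [Group H]

/-- The universal property of the twisted group ring: a family `u : G → B` in an `R`-algebra `B`
multiplying like the basis `ḡ` extends to an algebra homomorphism. -/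
def lift (α : Z2 G Rˣ) {B : Type*} [Ring B] [Algebra R B] (u : G → B)
    (u_one : u 1 = (((α : G → G → Rˣ) 1 1 : Rˣ) : R) • (1 : B))
    (u_mul : ∀ g h, u g * u h = (((α : G → G → Rˣ) g h : Rˣ) : R) • u (g * h)) :
    TwistedGroupRing α →ₐ[R] B :=
  AlgHom.ofLinearMap ((basis α).constr R u)
    (by
      rw [one_def, map_smul, Module.Basis.constr_basis, u_one, smul_smul, Units.inv_mul, one_smul])
    (fun x y => by
      have h : (mulHom α).compr₂ ((basis α).constr R u)
          = (LinearMap.mul R B).compl₁₂ ((basis α).constr R u) ((basis α).constr R u) :=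
        LinearMap.ext_basis (basis α) (basis α) fun g h => by
          simp [mulHom_basis, Module.Basis.constr_basis, u_mul]
      exact LinearMap.congr_fun₂ h x y)

theorem lift_basis (α : Z2 G Rˣ) {B : Type*} [Ring B] [Algebra R B] (u : G → B)
    (u_one : u 1 = (((α : G → G → Rˣ) 1 1 : Rˣ) : R) • (1 : B))
    (u_mul : ∀ g h, u g * u h = (((α : G → G → Rˣ) g h : Rˣ) : R) • u (g * h)) (g : G) :
    lift α u u_one u_mul (basis α g) = u g :=
  (basis α).constr_basis R u g

/-- Cocycles are not normalized, so the basis vector at `1` is only a unit multiple of the identity;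
this is the shape of the hypothesis `u_one` of `lift`. -/
theorem basis_one (α : Z2 G Rˣ) :
    basis α 1 = (((α : G → G → Rˣ) 1 1 : Rˣ) : R) • (1 : TwistedGroupRing α) := by
  rw [one_def, smul_smul, Units.mul_inv, one_smul]

/-- Cohomologous cocycles have isomorphic twisted group rings. -/
theorem nonempty_algEquiv_of_cls_eq {α β : Z2 G Rˣ} (h : cls α = cls β) :
    Nonempty (TwistedGroupRing α ≃ₐ[R] TwistedGroupRing β) := by
  obtain ⟨t, ht⟩ := QuotientGroup.eq.1 h
  have hβ : ∀ x y, (β : G → G → Rˣ) x y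
      = (α : G → G → Rˣ) x y * (t x * t y * (t (x * y))⁻¹) := fun x y => by
    rw [← ht x y]
    simp
  -- Since `β = α · ∂t`, rescaling each basis vector by `t⁻¹` cancels the coboundary.
  let u : G → TwistedGroupRing β := fun g => (((t g)⁻¹ : Rˣ) : R) • basis β g
  have u_mul : ∀ g h, u g * u h = (((α : G → G → Rˣ) g h : Rˣ) : R) • u (g * h) := fun g h => by
    simp only [u, smul_mul_smul_comm, basis_mul_basis, smul_smul, ← Units.val_mul, hβ]
    congr 2
    rw [show (t g)⁻¹ * (t h)⁻¹ * ((α : G → G → Rˣ) g h * (t g * t h * (t (g * h))⁻¹))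
      = ((t g)⁻¹ * t g) * ((t h)⁻¹ * t h) * ((α : G → G → Rˣ) g h * (t (g * h))⁻¹) by
        simp only [mul_assoc, mul_left_comm], inv_mul_cancel, inv_mul_cancel, one_mul, one_mul]
  have u_one : u 1 = (((α : G → G → Rˣ) 1 1 : Rˣ) : R) • (1 : TwistedGroupRing β) := by
    simp only [u, basis_one, smul_smul, ← Units.val_mul, hβ]
    congr 2
    simp [mul_comm]
  refine ⟨AlgEquiv.ofBijective (lift α u u_one u_mul) ?_⟩
  -- Bijectivity is linear: the map carries a basis to a basis rescaled by units.
  have e : ⇑(lift α u u_one u_mul)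
      = (basis α).equiv ((basis β).unitsSMul fun g => (t g)⁻¹) (Equiv.refl G) := by
    have : (lift α u u_one u_mul).toLinearMap
      = ((basis α).equiv ((basis β).unitsSMul fun g => (t g)⁻¹) (Equiv.refl G)).toLinearMap :=
      (basis α).ext fun g => by
        rw [AlgHom.toLinearMap_apply, lift_basis]
        simp [u, Module.Basis.unitsSMul_apply, Units.smul_def]
    exact congrArg DFunLike.coe this
  rw [e]
  exact LinearEquiv.bijective _

/-- The twisted group ring of a cocycle is isomorphic to that of its pullback along a group
isomorphism. -/
theorem nonempty_algEquiv_cocyclePullback (α : Z2 G Rˣ) (f : H ≃* G) :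
    Nonempty (TwistedGroupRing (cocyclePullback Rˣ f.toMonoidHom α) ≃ₐ[R] TwistedGroupRing α) := by
  let γ := cocyclePullback Rˣ f.toMonoidHom α
  have hγ : ∀ x y, (γ : H → H → Rˣ) x y = (α : G → G → Rˣ) (f x) (f y) := fun _ _ => rfl
  let u : H → TwistedGroupRing α := fun g => basis α (f g)
  have u_mul : ∀ g h, u g * u h = (((γ : H → H → Rˣ) g h : Rˣ) : R) • u (g * h) := fun g h => by
    simp only [u, basis_mul_basis, hγ, map_mul]
  have u_one : u 1 = (((γ : H → H → Rˣ) 1 1 : Rˣ) : R) • (1 : TwistedGroupRing α) := by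
    simp only [u, hγ, map_one, basis_one]
  refine ⟨AlgEquiv.ofBijective (lift γ u u_one u_mul) ?_⟩
  have e : ⇑(lift γ u u_one u_mul) = (basis γ).equiv (basis α) f.toEquiv := by
    have : (lift γ u u_one u_mul).toLinearMap
        = ((basis γ).equiv (basis α) f.toEquiv).toLinearMap :=
      (basis γ).ext fun g => by
        rw [AlgHom.toLinearMap_apply, lift_basis]
        simp [u]
    exact congrArg DFunLike.coe this
  rw [e]
  exact LinearEquiv.bijective _

end TwistedGroupRing

/-! ### Characters of a finite abelian group -/

/-- A complex function on a finite abelian group vanishes if it is orthogonal to all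
characters. -/
theorem eq_zero_of_sum_character_eq_zero {Z : Type*} [CommGroup Z] [Fintype Z] (f : Z → ℂ)
    (hf : ∀ χ : Z →* ℂˣ, ∑ z, f z * (χ z : ℂ) = 0) : f = 0 := by
  -- Duality: each `z` acts by evaluation as a character of the dual group. These evaluations are
  -- distinct because characters separate points, hence linearly independent by Dedekind, and `f` is
  -- the coefficient vector of a vanishing combination.
  let ev : Z → ((Z →* ℂˣ) →* ℂ) := fun z => (Units.coeHom ℂ).comp (MonoidHom.eval z)
  have ev_inj : Function.Injective ev := fun z w h => by
    by_contra hzw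
    obtain ⟨χ, hχ⟩ := CommGroup.exists_apply_ne_one_of_hasEnoughRootsOfUnity Z ℂ
      (a := z / w) (by rwa [Ne, div_eq_one])
    refine hχ ?_
    rw [map_div, div_eq_one]
    exact Units.ext (DFunLike.congr_fun h χ)
  have li := (linearIndependent_monoidHom (Z →* ℂˣ) ℂ).comp ev ev_inj
  funext z
  refine Fintype.linearIndependent_iff.1 li f (funext fun χ => ?_) z
  simpa [Finset.sum_apply, ev] using hf χ

/-! ### Splitting along the characters of a central subgroup -/

section Decomposition

variable {G : Type*} [Group G] {Z : Subgroup G} [Z.Normal]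

/-- The `Z`-component `g μ(gZ)⁻¹` of `g` with respect to a section `μ`. -/
def centralPart {μ : G ⧸ Z → G} (hμ : IsSection Z μ) (g : G) : Z :=
  ⟨g * (μ g)⁻¹, by
    rw [← QuotientGroup.eq_one_iff, QuotientGroup.mk_mul, QuotientGroup.mk_inv, hμ]
    exact mul_inv_cancel _⟩

/-- Inflated to `G`, the factor set becomes a coboundary, with `centralPart` as trivializing cochain
up to inversion. This is why transgressed classes die under inflation, and it makes the block maps
below multiplicative. -/
theorem centralPart_mul (hZ : Z ≤ Subgroup.center G) {μ : G ⧸ Z → G} (hμ : IsSection Z μ)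
    (g h : G) : centralPart hμ g * centralPart hμ h * factorSet Z hμ g h
      = centralPart hμ (g * h) := by
  apply Subtype.ext
  have hc : (centralPart hμ h : G) * μ g = μ g * centralPart hμ h :=
    (Subgroup.mem_center_iff.1 (hZ (centralPart hμ h).2) _).symm
  calc ((centralPart hμ g * centralPart hμ h * factorSet Z hμ g h : Z) : G)
      = centralPart hμ g * (centralPart hμ h * μ g) * μ h * (μ (g * h : G ⧸ Z))⁻¹ := by
        simp only [Subgroup.coe_mul, factorSet, mul_assoc]
    _ = g * h * (μ (g * h : G ⧸ Z))⁻¹ := by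
        rw [hc]
        simp only [centralPart]
        group
    _ = centralPart hμ (g * h) := rfl

/-- A group is in bijection with the product of the quotient by `Z` and `Z`. -/
def quotientProdEquiv {μ : G ⧸ Z → G} (hμ : IsSection Z μ) : (G ⧸ Z) × Z ≃ G where
  toFun p := p.2 * μ p.1
  invFun g := (g, centralPart hμ g)
  left_inv p := by
    have h : ((p.2 * μ p.1 : G) : G ⧸ Z) = p.1 := by
      rw [QuotientGroup.mk_mul, (QuotientGroup.eq_one_iff _).2 p.2.2, one_mul, hμ]
    refine Prod.ext h (Subtype.ext ?_)
    simp [centralPart, h]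
  right_inv g := by simp [centralPart]

variable [Finite G]

/-- The twisted group algebra of an inflated cocycle is the product, over the characters of the
central subgroup, of the twisted group algebras of the quotient, with the cocycle multiplied by
transgressions. -/
theorem nonempty_algEquiv_pi (hZ : Z ≤ Subgroup.center G) {μ : G ⧸ Z → G} (hμ : IsSection Z μ)
    (α : Z2 (G ⧸ Z) ℂˣ) :
    Nonempty (TwistedGroupRing (cocyclePullback ℂˣ (QuotientGroup.mk' Z) α) ≃ₐ[ℂ]
      ∀ χ : Z →* ℂˣ, TwistedGroupRing (α * traCocycle hZ hμ χ)) := by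
  classical
  let γ := cocyclePullback ℂˣ (QuotientGroup.mk' Z) α
  let δ : (Z →* ℂˣ) → Z2 (G ⧸ Z) ℂˣ := fun χ => α * traCocycle hZ hμ χ
  have hδ : ∀ χ x y, (δ χ : G ⧸ Z → G ⧸ Z → ℂˣ) x y
      = (α : G ⧸ Z → G ⧸ Z → ℂˣ) x y * χ (factorSet Z hμ x y) := fun _ _ _ => rfl
  have hγ : ∀ g h, (γ : G → G → ℂˣ) g h = (α : G ⧸ Z → G ⧸ Z → ℂˣ) g h := fun _ _ => rfl
  -- The scalar `χ (centralPart hμ g)` absorbs the twist by `tra χ`, which leaves only the inflated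
  -- cocycle.
  let u : G → ∀ χ, TwistedGroupRing (δ χ) := fun g χ =>
    ((χ (centralPart hμ g) : ℂˣ) : ℂ) • TwistedGroupRing.basis (δ χ) (g : G ⧸ Z)
  have u_mul : ∀ g h, u g * u h = (((γ : G → G → ℂˣ) g h : ℂˣ) : ℂ) • u (g * h) := fun g h => by
    funext χ
    simp only [u, Pi.mul_apply, Pi.smul_apply, smul_mul_smul_comm,
      TwistedGroupRing.basis_mul_basis, smul_smul, ← Units.val_mul, hδ, hγ,
      ← centralPart_mul hZ hμ g h, map_mul, QuotientGroup.mk_mul]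
    congr 2
    simp only [mul_left_comm]
  have u_one : u 1 = (((γ : G → G → ℂˣ) 1 1 : ℂˣ) : ℂ) • 1 := by
    funext χ
    -- The section need not send `1` to `1`: the two factors are `μ(1)⁻¹` and `μ(1)`.
    have h1 : centralPart hμ 1 * factorSet Z hμ 1 1 = 1 := by
      have := centralPart_mul hZ hμ 1 1
      rw [mul_one, mul_assoc, mul_eq_left] at this
      exact this
    simp only [u, Pi.smul_apply, Pi.one_apply, QuotientGroup.mk_one, TwistedGroupRing.basis_one,
      smul_smul, ← Units.val_mul, hδ, hγ]
    rw [mul_left_comm, ← map_mul, h1, map_one, mul_one]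
  -- Extending the existing group structure keeps `Z →* ℂˣ` the same type.
  let _ : CommGroup Z := { (inferInstance : Group Z) with
    mul_comm := fun a b => Subtype.ext (Subgroup.mem_center_iff.1 (hZ b.2) a) }
  have := Fintype.ofFinite G
  have := Fintype.ofFinite Z
  have := Fintype.ofFinite (G ⧸ Z)
  have : Finite (Z →* ℂˣ) := Nat.finite_of_card_ne_zero (by
    rw [CommGroup.card_monoidHom_of_hasEnoughRootsOfUnity Z ℂ]
    exact Nat.card_pos.ne')
  have := Fintype.ofFinite (Z →* ℂˣ)
  let F := TwistedGroupRing.lift γ u u_one u_mul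
  have F_inj : Function.Injective F := by
    rw [injective_iff_map_eq_zero]
    intro a ha
    have ha' : ∑ g, (TwistedGroupRing.basis γ).repr a g • u g = 0 := by
      rw [← ha]
      conv_rhs => rw [← (TwistedGroupRing.basis γ).sum_repr a, map_sum]
      exact Finset.sum_congr rfl fun g _ => by
        rw [map_smul, TwistedGroupRing.lift_basis]
    -- On a fixed coset `x`, the coefficient at `x` of the `χ`-component of `F a` is the character
    -- sum at `χ` of `z ↦ a(z μ(x))`. All these sums vanish, so the function does.
    have key : ∀ x : G ⧸ Z,
        (fun z : Z => (TwistedGroupRing.basis γ).repr a (quotientProdEquiv hμ (x, z))) = 0 := by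
      intro x
      refine eq_zero_of_sum_character_eq_zero _ fun χ => ?_
      have h := congrFun ha' χ
      rw [Finset.sum_apply, ← (quotientProdEquiv hμ).sum_comp, Fintype.sum_prod_type] at h
      have hp : ∀ (y : G ⧸ Z) (z : Z), u (quotientProdEquiv hμ (y, z)) χ
          = ((χ z : ℂˣ) : ℂ) • TwistedGroupRing.basis (δ χ) y := fun y z => by
        have e := (quotientProdEquiv hμ).left_inv (y, z)
        have e1 : ((quotientProdEquiv hμ (y, z) : G) : G ⧸ Z) = y := congrArg Prod.fst e
        have e2 : centralPart hμ (quotientProdEquiv hμ (y, z)) = z := congrArg Prod.snd e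
        simp only [u, e1, e2]
      simp only [Pi.smul_apply, hp, smul_smul, ← Finset.sum_smul, Pi.zero_apply] at h
      exact Fintype.linearIndependent_iff.1 (TwistedGroupRing.basis (δ χ)).linearIndependent _ h x
    refine (TwistedGroupRing.basis γ).ext_elem fun g => ?_
    obtain ⟨⟨x, z⟩, rfl⟩ := (quotientProdEquiv hμ).surjective g
    rw [map_zero]
    exact congrFun (key x) z
  have : ∀ χ, Module.Finite ℂ (TwistedGroupRing (δ χ)) := fun χ =>
    Module.Finite.of_basis (TwistedGroupRing.basis (δ χ))
  have : Module.Finite ℂ (TwistedGroupRing γ) :=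
    Module.Finite.of_basis (TwistedGroupRing.basis γ)
  -- Injectivity suffices once dimensions agree: `|G| = |G/Z| · |Z|`, and `Z` has exactly `|Z|`
  -- complex characters.
  have dim : Module.finrank ℂ (TwistedGroupRing γ)
      = Module.finrank ℂ (∀ χ, TwistedGroupRing (δ χ)) := by
    rw [Module.finrank_pi_fintype, Module.finrank_eq_card_basis (TwistedGroupRing.basis γ)]
    simp only [fun χ => Module.finrank_eq_card_basis (TwistedGroupRing.basis (δ χ)),
      Finset.sum_const, Finset.card_univ, smul_eq_mul]
    rw [← Fintype.card_congr (quotientProdEquiv hμ), Fintype.card_prod, mul_comm]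
    congr 1
    rw [← Nat.card_eq_fintype_card, ← Nat.card_eq_fintype_card,
      CommGroup.card_monoidHom_of_hasEnoughRootsOfUnity Z ℂ]
  exact ⟨AlgEquiv.ofBijective F ⟨F_inj,
    (LinearMap.injective_iff_surjective_of_finrank_eq_finrank (f := F.toLinearMap) dim).1 F_inj⟩⟩

end Decomposition

/-! ### Transport of cohomology groups -/

/-- The isomorphism of second cohomology groups induced by a group isomorphism. -/
def pullbackEquiv {G H : Type*} [Group G] [Group H] (A : Type*) [CommGroup A] (f : H ≃* G) :
    H2 G A ≃* H2 H A :=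
  MonoidHom.toMulEquiv (pullback A f.toMonoidHom) (pullback A f.symm.toMonoidHom)
    (by
      ext α
      refine congrArg cls (Subtype.ext ?_)
      funext x y
      simp [cocyclePullback])
    (by
      ext α
      refine congrArg cls (Subtype.ext ?_)
      funext x y
      simp [cocyclePullback])

/-- An isomorphism of groups compatible with the kernels of two surjective homomorphisms descends
to the targets. -/
theorem exists_mulEquiv_of_map_ker {A B C D : Type*} [CommGroup A] [CommGroup B] [Group C]
    [Group D] {f : A →* C} {g : B →* D} (hf : Function.Surjective f)
    (hg : Function.Surjective g) (e : A ≃* B) (he : f.ker.map e.toMonoidHom = g.ker) :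
    ∃ ψ : C ≃* D, ∀ a, ψ (f a) = g (e a) := by
  refine ⟨(QuotientGroup.quotientKerEquivOfSurjective f hf).symm.trans
    ((QuotientGroup.congr f.ker g.ker e he).trans
      (QuotientGroup.quotientKerEquivOfSurjective g hg)), fun a => ?_⟩
  have : (QuotientGroup.quotientKerEquivOfSurjective f hf).symm (f a) = (a : A ⧸ f.ker) := by
    rw [MulEquiv.symm_apply_eq]
    rfl
  simp only [MulEquiv.trans_apply, this]
  rfl

end TGR

end

/-! ### The equivalence of `G₁` and `G₂` -/

theorem corollary1p2 {G₁ G₂ : Type*} [Group G₁] [Finite G₁] [Group G₂] [Finite G₂]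
    (Z₁ : Subgroup G₁) [Z₁.Normal] (hZ₁ : Z₁ ≤ Subgroup.center G₁)
    (Z₂ : Subgroup G₂) [Z₂.Normal] (hZ₂ : Z₂ ≤ Subgroup.center G₂)
    (tra₁_injective : Function.Injective (TGR.transgression ℂˣ hZ₁))
    (exact₁ : (TGR.transgression ℂˣ hZ₁).range = (TGR.inflation ℂˣ Z₁).ker)
    (inf₁_surjective : Function.Surjective (TGR.inflation ℂˣ Z₁))
    (tra₂_injective : Function.Injective (TGR.transgression ℂˣ hZ₂))
    (exact₂ : (TGR.transgression ℂˣ hZ₂).range = (TGR.inflation ℂˣ Z₂).ker)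
    (inf₂_surjective : Function.Surjective (TGR.inflation ℂˣ Z₂))
    (i : Z₂ ≃* Z₁) (φ : G₂ ⧸ Z₂ ≃* G₁ ⧸ Z₁)
    (comm : ∀ χ : Z₁ →* ℂˣ,
      TGR.pullback ℂˣ φ.toMonoidHom (TGR.transgression ℂˣ hZ₁ χ)
        = TGR.transgression ℂˣ hZ₂ (χ.comp i.toMonoidHom)) :
    TGR.TwistedEquiv ℂ G₁ G₂ := by
  have hker : (TGR.inflation ℂˣ Z₁).ker.map (TGR.pullbackEquiv ℂˣ φ).toMonoidHom
      = (TGR.inflation ℂˣ Z₂).ker := by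
    rw [← exact₁, ← exact₂]
    ext c
    constructor
    · rintro ⟨_, ⟨χ, rfl⟩, rfl⟩
      exact ⟨_, (comm χ).symm⟩
    · rintro ⟨χ, rfl⟩
      -- Bijectivity of `i` is what gives all of `im tra₂`: the element `tra₂ χ` comes from `tra₁ (χ
      -- ∘ i⁻¹)`.
      refine ⟨_, ⟨χ.comp i.symm.toMonoidHom, rfl⟩, (comm _).trans ?_⟩
      congr 1
      ext z
      simp
  obtain ⟨ψ, hψ⟩ := TGR.exists_mulEquiv_of_map_ker (A := TGR.H2 (G₁ ⧸ Z₁) ℂˣ)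
    (B := TGR.H2 (G₂ ⧸ Z₂) ℂˣ) (C := TGR.H2 G₁ ℂˣ) (D := TGR.H2 G₂ ℂˣ)
    (f := TGR.inflation ℂˣ Z₁) (g := TGR.inflation ℂˣ Z₂) inf₁_surjective inf₂_surjective
    (TGR.pullbackEquiv ℂˣ φ) hker
  refine ⟨ψ, fun α β hαβ => ?_⟩
  obtain ⟨a, ha⟩ := inf₁_surjective (TGR.cls α)
  obtain ⟨α', rfl⟩ := QuotientGroup.mk_surjective a
  let β' := TGR.cocyclePullback ℂˣ φ.toMonoidHom α'
  -- The defining property of `ψ`: it sends `inf₁ [α']` to `inf₂ [β']`. So `β` may be replaced by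
  -- the inflation of `β'`.
  have hβ : TGR.cls (TGR.cocyclePullback ℂˣ (QuotientGroup.mk' Z₂) β') = TGR.cls β := by
    rw [← hαβ, ← ha, hψ]
    rfl
  obtain ⟨e₁⟩ := TGR.TwistedGroupRing.nonempty_algEquiv_of_cls_eq
    (α := TGR.cocyclePullback ℂˣ (QuotientGroup.mk' Z₁) α') (β := α) ha
  obtain ⟨e₂⟩ := TGR.TwistedGroupRing.nonempty_algEquiv_of_cls_eq hβ
  obtain ⟨d₁⟩ := TGR.nonempty_algEquiv_pi hZ₁ (TGR.isSection_out Z₁) α'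
  obtain ⟨d₂⟩ := TGR.nonempty_algEquiv_pi hZ₂ (TGR.isSection_out Z₂) β'
  let ι : (Z₁ →* ℂˣ) ≃ (Z₂ →* ℂˣ) :=
    { toFun := fun χ => χ.comp i.toMonoidHom
      invFun := fun χ => χ.comp i.symm.toMonoidHom
      left_inv := fun χ => by ext z; simp
      right_inv := fun χ => by ext z; simp }
  have comp : ∀ χ : Z₁ →* ℂˣ, Nonempty
      (TGR.TwistedGroupRing (α' * TGR.traCocycle hZ₁ (TGR.isSection_out Z₁) χ) ≃ₐ[ℂ]
        TGR.TwistedGroupRing (β' * TGR.traCocycle hZ₂ (TGR.isSection_out Z₂) (ι χ))) := by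
    intro χ
    obtain ⟨p⟩ := TGR.TwistedGroupRing.nonempty_algEquiv_cocyclePullback
      (α' * TGR.traCocycle hZ₁ (TGR.isSection_out Z₁) χ) φ
    -- The chosen sections of the two quotients are unrelated, so the cocycles may differ; their
    -- classes agree by the commuting square multiplied by `[β']`.
    obtain ⟨q⟩ := TGR.TwistedGroupRing.nonempty_algEquiv_of_cls_eq
      (α := TGR.cocyclePullback ℂˣ φ.toMonoidHom
        (α' * TGR.traCocycle hZ₁ (TGR.isSection_out Z₁) χ))
      (β := β' * TGR.traCocycle hZ₂ (TGR.isSection_out Z₂) (ι χ))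
      (congrArg (TGR.cls β' * ·) (comm χ))
    exact ⟨p.symm.trans q⟩
  exact ⟨e₁.symm.trans <| d₁.trans <| (AlgEquiv.piCongrRight fun χ => (comp χ).some).trans <|
    (AlgEquiv.piCongrLeft ℂ (fun χ : Z₂ →* ℂˣ => TGR.TwistedGroupRing
      (β' * TGR.traCocycle hZ₂ (TGR.isSection_out Z₂) χ)) ι).trans <| d₂.symm.trans e₂⟩
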